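/- Let $\mathcal G$ be a finite simple undirected graph with adjacency matrix $A\in\{0,1\}^{n\times n}$. Let $I$ be the identity matrix, $J$ the $n\times n$ matrix with zeros on the diagonal and ones elsewhere, $\mathbf 1$ the all-ones vector, $\odot$ the entrywise product, $\mathrm{diag}(v)$ the diagonal matrix with diagonal $v$, and $(M>0)$ the $0/1$ matrix indicating the positive entries of $M$. Put \begin{align*} X_2 &= A^2\odot J,\\ X_3 &= A^3\odot J - A(A^2\odot I) - (A^2\odot I)A + A,\\ X_4 &= A^4\odot J - \bigl(A(A^2\odot I-2I)A\bigr)\odot J - (A^2\odot I)X_2 - X_2(A^2\odot I)\\ &\quad - A(A^3\odot I) - (A^3\odot I)A + 3\,A^2\odot A,\\ X_5 &= A^5\odot J - A(A^2\odot I)(A^2\odot I-I) - (A^2\odot I)A(A^2\odot I) - (A^2\odot I-I)(A^2\odot I)A\\ &\quad - \bigl(A(A^2\odot I-I)X_2\bigr)\odot J - \bigl(X_2(A^2\odot I-I)A\bigr)\odot J - (A^2\odot I)X_3 - X_3(A^2\odot I-I)\\ &\quad - (A^3\odot I)X_2 - X_2(A^3\odot I) - \bigl(A(A^3\odot I)A\bigr)\odot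 J - A\odot A^2\\ &\quad + 3\bigl(A(A\odot A^2)+(A\odot A^2)A\bigr)\odot J - A\,\mathrm{diag}\bigl((A\odot X_3)\mathbf 1\bigr) - \mathrm{diag}\bigl((A\odot X_3)\mathbf 1\bigr)A\\ &\quad + 3\,A\odot X_3 + 3\,A\odot A^2\odot\bigl(A^2-(A^2>0)\bigr). \end{align*} For $3\le l\le 6$ let $C_l = A\odot X_{l-1}$. Then for all nodes $i,j$ the entry $(C_l)_{i,j}$ equals the number of $l$-cycles of $\mathcal G$ containing the edge $(i,j)$, i.e. the number of subgraphs of $\mathcal G$ that are isomorphic to the cycle on $l$ vertices and have $\{i,j\}$ as an edge (so it is $0$ if $\{i,j\}$ is not an edge of $\mathcal G$). -/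

import Mathlib

open scoped Matrix

namespace EdgeCycles

variable {V : Type*} [Fintype V] [DecidableEq V]

/-- The matrix `J` whose off-diagonal entries are `1` and whose diagonal entries are `0`. -/
def offDiagOnes (V : Type*) [DecidableEq V] : Matrix V V ℝ :=
  Matrix.of fun i j => if i = j then 0 else 1

/-- The entrywise indicator `(M > 0)` of the positive entries of `M`. -/
noncomputable def posIndicator (M : Matrix V V ℝ) : Matrix V V ℝ :=
  Matrix.of fun i j => if 0 < M i j then 1 else 0

/-- `X₂ = A² ⊙ J`. -/
def X2 (A : Matrix V V ℝ) : Matrix V V ℝ :=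
  (A ^ 2) ⊙ offDiagOnes V

/-- `X₃ = A³ ⊙ J - A(A² ⊙ I) - (A² ⊙ I)A + A`. -/
def X3 (A : Matrix V V ℝ) : Matrix V V ℝ :=
  (A ^ 3) ⊙ offDiagOnes V - A * ((A ^ 2) ⊙ 1) - ((A ^ 2) ⊙ 1) * A + A

/-- The matrix word `X₄` in `A`. -/
def X4 (A : Matrix V V ℝ) : Matrix V V ℝ :=
  (A ^ 4) ⊙ offDiagOnes V
    - (A * ((A ^ 2) ⊙ 1 - (2 : ℝ) • 1) * A) ⊙ offDiagOnes V
    - ((A ^ 2) ⊙ 1) * X2 A - X2 A * ((A ^ 2) ⊙ 1)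
    - A * ((A ^ 3) ⊙ 1) - ((A ^ 3) ⊙ 1) * A + (3 : ℝ) • ((A ^ 2) ⊙ A)

/-- The matrix word `X₅` in `A`. -/
noncomputable def X5 (A : Matrix V V ℝ) : Matrix V V ℝ :=
  (A ^ 5) ⊙ offDiagOnes V
    - A * ((A ^ 2) ⊙ 1) * ((A ^ 2) ⊙ 1 - 1)
    - ((A ^ 2) ⊙ 1) * A * ((A ^ 2) ⊙ 1)
    - ((A ^ 2) ⊙ 1 - 1) * ((A ^ 2) ⊙ 1) * A
    - (A * ((A ^ 2) ⊙ 1 - 1) * X2 A) ⊙ offDiagOnes V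
    - (X2 A * ((A ^ 2) ⊙ 1 - 1) * A) ⊙ offDiagOnes V
    - ((A ^ 2) ⊙ 1) * X3 A - X3 A * ((A ^ 2) ⊙ 1 - 1)
    - ((A ^ 3) ⊙ 1) * X2 A - X2 A * ((A ^ 3) ⊙ 1)
    - (A * ((A ^ 3) ⊙ 1) * A) ⊙ offDiagOnes V - A ⊙ (A ^ 2)
    + (3 : ℝ) • ((A * (A ⊙ (A ^ 2)) + (A ⊙ (A ^ 2)) * A) ⊙ offDiagOnes V)
    - A * Matrix.diagonal ((A ⊙ X3 A) *ᵥ 1) - Matrix.diagonal ((A ⊙ X3 A) *ᵥ 1) * A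
    + (3 : ℝ) • (A ⊙ X3 A)
    + (3 : ℝ) • (A ⊙ (A ^ 2) ⊙ (A ^ 2 - posIndicator (A ^ 2)))

/-- The matrices `X_l`, for `2 ≤ l ≤ 5` (other indices are not used and get the value `0`). -/
noncomputable def X (A : Matrix V V ℝ) : ℕ → Matrix V V ℝ
  | 2 => X2 A
  | 3 => X3 A
  | 4 => X4 A
  | 5 => X5 A
  | _ => 0

/-- `C_l = A ⊙ X_{l-1}`. -/
noncomputable def C (A : Matrix V V ℝ) (l : ℕ) : Matrix V V ℝ :=
  A ⊙ X A (l - 1)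

/-- The number of `l`-cycles of `G` through the edge `(i, j)`: the number of subgraphs of `G`
that are isomorphic to the cycle graph on `l ≥ 3` vertices and have `(i, j)` as an edge.
It is `0` when `(i, j)` is not an edge of `G`. -/
noncomputable def cycleCount {V : Type*} (G : SimpleGraph V) (l : ℕ) (i j : V) : ℕ :=
  {H : G.Subgraph | Nonempty (H.coe ≃g SimpleGraph.cycleGraph l) ∧ H.Adj i j}.ncard

end EdgeCycles

open scoped Matrix

namespace EdgeCycles

variable {V : Type*} [Fintype V] [DecidableEq V]

/-! Off the edges both sides vanish, so let `A i j = 1`. An `l`-cycle through the edge is a path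
from `i` to `j` with `l - 2` inner vertices, closed up by the edge itself. Prescribing the first
vertex `i` and the last vertex `j` leaves no rotation or reflection free, so cycles correspond to
injective closed tours (`cycleCount_eq_ncard`).

For `l = 3` the tours are counted by `A ^ 2`. For larger `l` they are counted by the nested sums
`pathSum3`, `pathSum4`, `pathSum5`, whose guards exclude coincidences between non-consecutive
vertices; looplessness excludes the others.

A guarded sum is the full sum minus its values at the excluded points, which are distinct. Working
from the innermost sum outwards, full sums become entries of powers of `A`, and the corrections
simplify because the entries of `A` are idempotent. This gives the polynomials of `pathSum3_eq`,
`pathSum4_eq` and `pathSum5_eq`; expanding `X3`, `X4`, `X5` at the edge gives the same polynomials.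
-/

/-! ### Punctured sums and 0/1 matrices -/

theorem sum_ite_eq_zero_else (g : V → ℝ) (p : V) :
    ∑ x, (if x = p then 0 else g x) = ∑ x, g x - g p := by
  have h : ∀ x, (if x = p then 0 else g x) = g x - if x = p then g x else 0 := fun x => by
    split_ifs <;> simp
  simp [h]

theorem sum_ite_or_zero_else {p q : V} (g : V → ℝ) (hpq : p ≠ q) :
    ∑ x, (if x = p ∨ x = q then 0 else g x) = ∑ x, g x - g p - g q := by
  have h : ∀ x, (if x = p ∨ x = q then 0 else g x) =
      if x = p then 0 else (if x = q then 0 else g x) := fun x => by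
    split_ifs <;> simp_all
  simp only [h, sum_ite_eq_zero_else, if_neg hpq]
  ring

theorem sum_ite_or_or_zero_else {p q r : V} (g : V → ℝ) (hpq : p ≠ q) (hpr : p ≠ r)
    (hqr : q ≠ r) :
    ∑ x, (if x = p ∨ x = q ∨ x = r then 0 else g x) = ∑ x, g x - g p - g q - g r := by
  have h : ∀ x, (if x = p ∨ x = q ∨ x = r then 0 else g x) =
      if x = p then 0 else (if x = q ∨ x = r then 0 else g x) := fun x => by
    split_ifs <;> simp_all
  simp only [h, sum_ite_eq_zero_else, sum_ite_or_zero_else _ hqr, if_neg (not_or.2 ⟨hpq, hpr⟩)]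
  ring

/-- The real `0/1` matrices that are adjacency matrices of simple graphs. -/
structure IsAdj (A : Matrix V V ℝ) : Prop where
  zero_or_one : ∀ x y, A x y = 0 ∨ A x y = 1
  symm : ∀ x y, A x y = A y x
  loopless : ∀ x, A x x = 0

variable {A : Matrix V V ℝ}

theorem pow_succ_apply (A : Matrix V V ℝ) (n : ℕ) (x y : V) :
    (A ^ (n + 1)) x y = ∑ z, A x z * (A ^ n) z y := by
  rw [pow_succ', Matrix.mul_apply]

theorem pow_succ_apply' (A : Matrix V V ℝ) (n : ℕ) (x y : V) :
    (A ^ (n + 1)) x y = ∑ z, (A ^ n) x z * A z y := by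
  rw [pow_succ, Matrix.mul_apply]

namespace IsAdj

theorem pow_symm (hA : IsAdj A) (n : ℕ) (x y : V) : (A ^ n) x y = (A ^ n) y x := by
  have h : Aᵀ = A := Matrix.ext fun x y => hA.symm y x
  conv_lhs => rw [← h, ← Matrix.transpose_pow, Matrix.transpose_apply]

omit [Fintype V] [DecidableEq V] in
theorem mul_self_apply (hA : IsAdj A) (x y : V) : A x y * A x y = A x y := by
  rcases hA.zero_or_one x y with h | h <;> simp [h]

theorem sq_apply (_hA : IsAdj A) (x y : V) : (A ^ 2) x y = ∑ z, A x z * A z y := by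
  rw [pow_succ_apply, pow_one]

theorem degree_eq (hA : IsAdj A) (x : V) : (A ^ 2) x x = ∑ z, A x z := by
  rw [hA.sq_apply]
  exact Finset.sum_congr rfl fun z _ => by rw [hA.symm z x, hA.mul_self_apply]

end IsAdj

/-! ### Closed forms of the path counts -/

/-- Number of paths with two inner vertices from `i` to `j`. -/
noncomputable def pathSum3 (A : Matrix V V ℝ) (i j : V) : ℝ :=
  ∑ a, if a = j then 0 else A i a * ∑ b, if b = i then 0 else A a b * A b j

/-- Number of paths with three inner vertices from `i` to `j`. -/
noncomputable def pathSum4 (A : Matrix V V ℝ) (i j : V) : ℝ :=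
  ∑ a, if a = j then 0 else A i a * ∑ b, if b = i ∨ b = j then 0 else A a b *
    ∑ c, if c = i ∨ c = a then 0 else A b c * A c j

/-- Number of paths with four inner vertices from `i` to `j`. -/
noncomputable def pathSum5 (A : Matrix V V ℝ) (i j : V) : ℝ :=
  ∑ a, if a = j then 0 else A i a * ∑ b, if b = i ∨ b = j then 0 else A a b *
    ∑ c, if c = i ∨ c = a ∨ c = j then 0 else A b c *
      ∑ d, if d = i ∨ d = a ∨ d = b then 0 else A c d * A d j

theorem pathSum3_eq (hA : IsAdj A) {i j : V} (hij : A i j = 1) :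
    pathSum3 A i j = (A ^ 3) i j - (A ^ 2) i i - (A ^ 2) j j + 1 := by
  have hji : A j i = 1 := by rw [hA.symm, hij]
  have h1 : ∀ a, (∑ b, if b = i then 0 else A a b * A b j) = (A ^ 2) a j - A i a := fun a => by
    rw [sum_ite_eq_zero_else, hA.sq_apply, hij, hA.symm a i, mul_one]
  simp only [pathSum3, h1, sum_ite_eq_zero_else, hij]
  rw [pow_succ_apply A 2, hA.degree_eq i]
  simp only [one_mul, sub_eq_add_neg, mul_add, Finset.sum_add_distrib, mul_neg, hA.mul_self_apply,
    Finset.sum_neg_distrib]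
  ring

omit [Fintype V] [DecidableEq V] in
-- Lets the inner sums be evaluated under the assumption that the vertices chosen so far are
-- adjacent, since the factor `A x y` kills the other terms.
theorem IsAdj.mul_congr (hA : IsAdj A) {x y : V} {u v : ℝ} (h : A x y = 1 → u = v) :
    A x y * u = A x y * v := by
  rcases hA.zero_or_one x y with h0 | h1
  · simp [h0]
  · rw [h h1]

omit [Fintype V] [DecidableEq V] in
theorem IsAdj.ne (hA : IsAdj A) {x y : V} (h : A x y = 1) : x ≠ y := by
  rintro rfl; simp [hA.loopless] at h

theorem pathSum4_eq (hA : IsAdj A) {i j : V} (hij : A i j = 1) :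
    pathSum4 A i j = (A ^ 4) i j - ∑ a, A i a * (A ^ 2) a a * A a j
      - ((A ^ 2) i i + (A ^ 2) j j) * (A ^ 2) i j
      - (A ^ 3) i i - (A ^ 3) j j + 5 * (A ^ 2) i j := by
  have hji : A j i = 1 := by rw [hA.symm, hij]
  have hne : i ≠ j := hA.ne hij
  have h1 : ∀ a b, A i a = 1 → (∑ c, if c = i ∨ c = a then 0 else A b c * A c j) =
      (A ^ 2) b j - A b i - A b a * A a j := fun a b ha => by
    rw [sum_ite_or_zero_else _ (hA.ne ha), hA.sq_apply, hij, mul_one]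
  have h2 : ∀ a, A i a = 1 → (∑ b, if b = i ∨ b = j then 0 else A a b *
      ∑ c, if c = i ∨ c = a then 0 else A b c * A c j) =
      (A ^ 3) a j - (A ^ 2) a i - (A ^ 2) a a * A a j - (A ^ 2) i j + 3 * A a j
        - A a j * (A ^ 2) j j := fun a ha => by
    simp only [h1 a _ ha]
    rw [sum_ite_or_zero_else _ hne, pow_succ_apply A 2, hA.sq_apply a i, hA.sq_apply a a]
    simp only [mul_sub, Finset.sum_sub_distrib, hji, ha, hA.loopless, hA.symm a i,
      hA.symm j a, ← mul_assoc, ← Finset.sum_mul]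
    -- Only powers of the entry `A a j` remain to be reduced, by idempotence.
    linear_combination 2 * hA.mul_self_apply a j + (A a j - 1) * hA.mul_self_apply a j
  have h3 : pathSum4 A i j = ∑ a, if a = j then 0 else A i a *
      ((A ^ 3) a j - (A ^ 2) a i - (A ^ 2) a a * A a j - (A ^ 2) i j + 3 * A a j
        - A a j * (A ^ 2) j j) :=
    Finset.sum_congr rfl fun a _ => by rw [hA.mul_congr (h2 a)]
  rw [h3, sum_ite_eq_zero_else, pow_succ_apply A 3 i j, pow_succ_apply A 2 i i, hA.degree_eq i]
  simp only [mul_sub, mul_add, Finset.sum_sub_distrib, Finset.sum_add_distrib, hij, hA.loopless]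
  have e1 : ∑ a, A i a * (3 * A a j) = 3 * (A ^ 2) i j := by
    rw [hA.sq_apply, Finset.mul_sum]; exact Finset.sum_congr rfl fun _ _ => by ring
  have e2 : ∑ a, A i a * (A a j * (A ^ 2) j j) = (A ^ 2) i j * (A ^ 2) j j := by
    rw [hA.sq_apply i j, Finset.sum_mul]; exact Finset.sum_congr rfl fun _ _ => by ring
  rw [e1, e2, hA.pow_symm 2 j i, ← Finset.sum_mul]
  simp only [mul_assoc]
  ring

theorem pathSum5_eq (hA : IsAdj A) {i j : V} (hij : A i j = 1) :
    pathSum5 A i j = (A ^ 5) i j - (A ^ 4) i i - (A ^ 4) j j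
      - ∑ a, A i a * (A ^ 3) a a * A a j
      - ∑ a, (A ^ 2) i a * (A ^ 2) a a * A a j - ∑ a, A i a * (A ^ 2) a a * (A ^ 2) a j
      - ((A ^ 3) i i + (A ^ 3) j j) * (A ^ 2) i j
      + 3 * ∑ a, A i a * (A ^ 2) i a * A a j + 3 * ∑ a, A i a * (A ^ 2) a j * A a j
      + ∑ a, A i a * (A ^ 2) a a + ∑ a, A j a * (A ^ 2) a a
      + (A ^ 3) i j * (6 - (A ^ 2) i i - (A ^ 2) j j)
      + 2 * (A ^ 2) i i ^ 2 + 2 * (A ^ 2) j j ^ 2 + (A ^ 2) i i * (A ^ 2) j j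
      - 6 * (A ^ 2) i i - 6 * (A ^ 2) j j + 4 + 3 * (A ^ 2) i j ^ 2 - 4 * (A ^ 2) i j := by
  have hji : A j i = 1 := by rw [hA.symm, hij]
  have hne : i ≠ j := hA.ne hij
  have h1 : ∀ a b c, A i a = 1 → A a b = 1 → b ≠ i →
      (∑ d, if d = i ∨ d = a ∨ d = b then 0 else A c d * A d j) =
      (A ^ 2) c j - A c i - A c a * A a j - A c b * A b j := fun a b c ha hb hbi => by
    rw [sum_ite_or_or_zero_else _ (hA.ne ha) hbi.symm (hA.ne hb), hA.sq_apply, hij, mul_one]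
  have h2 : ∀ a b, A i a = 1 → a ≠ j → A a b = 1 → b ≠ i →
      (∑ c, if c = i ∨ c = a ∨ c = j then 0 else A b c *
        ∑ d, if d = i ∨ d = a ∨ d = b then 0 else A c d * A d j) =
      (A ^ 3) b j - (A ^ 2) b i - (A ^ 2) b a * A a j - (A ^ 2) b b * A b j
        - A b i * ((A ^ 2) i j - A a j) + A b i * A b j - A b a * (A ^ 2) a j + A b a
        + A b a * A b j - A b j * ((A ^ 2) j j - 2 - A a j) := fun a b ha haj hb hbi => by
    simp only [h1 a b _ ha hb hbi]
    rw [sum_ite_or_or_zero_else _ (hA.ne ha) hne haj, pow_succ_apply A 2 b j,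
      hA.sq_apply b i, hA.sq_apply b a, hA.sq_apply b b]
    simp only [mul_sub, Finset.sum_sub_distrib, hji, ha, hb, hA.loopless, hA.symm a i,
      hA.symm j a, hA.symm i b, hA.symm j b, hA.symm b a, ← mul_assoc, ← Finset.sum_mul]
    -- Fixing the values of these 0/1 entries replaces all uses of idempotence.
    rcases hA.zero_or_one b j with h | h <;> rcases hA.zero_or_one a j with h' | h' <;>
    rcases hA.zero_or_one b i with h'' | h'' <;> simp only [h, h', h''] <;> ring
  have h3 : ∀ a, A i a = 1 → a ≠ j → (∑ b, if b = i ∨ b = j then 0 else A a b *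
      ∑ c, if c = i ∨ c = a ∨ c = j then 0 else A b c *
        ∑ d, if d = i ∨ d = a ∨ d = b then 0 else A c d * A d j) =
      (A ^ 4) a j - (A ^ 3) a i - (A ^ 3) a a * A a j - ∑ b, A a b * (A ^ 2) b b * A b j
        - (A ^ 2) a i * ((A ^ 2) i j - A a j) + ∑ b, A a b * (A b i * A b j)
        - (A ^ 2) a a * (A ^ 2) a j + (A ^ 2) a a + (A ^ 2) a j
        - (A ^ 2) a j * ((A ^ 2) j j - 2 - A a j)
        - ((A ^ 3) i j - 2 * (A ^ 2) i i - (A ^ 2) i a * A a j - (A ^ 2) a j + 4 - (A ^ 2) j j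
          + A a j)
        - A a j * ((A ^ 3) j j - 2 * (A ^ 2) i j - 2 * (A ^ 2) a j + 2) := fun a ha haj => by
    have : ∀ b, (if b = i ∨ b = j then 0 else A a b *
      ∑ c, if c = i ∨ c = a ∨ c = j then 0 else A b c *
        ∑ d, if d = i ∨ d = a ∨ d = b then 0 else A c d * A d j) =
        if b = i ∨ b = j then 0 else A a b *
        ((A ^ 3) b j - (A ^ 2) b i - (A ^ 2) b a * A a j - (A ^ 2) b b * A b j
        - A b i * ((A ^ 2) i j - A a j) + A b i * A b j - A b a * (A ^ 2) a j + A b a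
        + A b a * A b j - A b j * ((A ^ 2) j j - 2 - A a j)) := fun b => by
      split_ifs with hb
      · rfl
      · exact hA.mul_congr fun h => h2 a b ha haj h fun e => hb (Or.inl e)
    simp only [this]
    have hab : ∀ b, A a b * A b a = A a b := fun b => by rw [hA.symm b a, hA.mul_self_apply]
    rw [sum_ite_or_zero_else _ hne, pow_succ_apply A 3 a j, pow_succ_apply A 2 a i,
      pow_succ_apply A 2 a a, hA.degree_eq a, hA.sq_apply a i, hA.sq_apply a j]
    simp only [mul_sub, mul_add, Finset.sum_sub_distrib, Finset.sum_add_distrib, ← mul_assoc, hab,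
      ← Finset.sum_mul]
    simp only [hij, hji, ha, hA.loopless, hA.symm a i, hA.pow_symm 2 j i, hA.pow_symm 2 j a,
      ← hA.sq_apply]
    rcases hA.zero_or_one a j with h | h <;> simp only [h] <;> ring
  have h4 : pathSum5 A i j = ∑ a, if a = j then 0 else A i a *
      ((A ^ 4) a j - (A ^ 3) a i - (A ^ 3) a a * A a j - ∑ b, A a b * (A ^ 2) b b * A b j
        - (A ^ 2) a i * ((A ^ 2) i j - A a j) + ∑ b, A a b * (A b i * A b j)
        - (A ^ 2) a a * (A ^ 2) a j + (A ^ 2) a a + (A ^ 2) a j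
        - (A ^ 2) a j * ((A ^ 2) j j - 2 - A a j)
        - ((A ^ 3) i j - 2 * (A ^ 2) i i - (A ^ 2) i a * A a j - (A ^ 2) a j + 4 - (A ^ 2) j j
          + A a j)
        - A a j * ((A ^ 3) j j - 2 * (A ^ 2) i j - 2 * (A ^ 2) a j + 2)) :=
    Finset.sum_congr rfl fun a _ => by
      split_ifs with ha
      · rfl
      · exact hA.mul_congr fun h => h3 a h ha
  -- Exchanging the two sums turns the sum over `a` into an entry of `A ^ 2`.
  have e1 : ∑ a, A i a * ∑ b, A a b * (A ^ 2) b b * A b j =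
      ∑ b, (A ^ 2) i b * (A ^ 2) b b * A b j := by
    simp only [hA.sq_apply i, Finset.mul_sum, Finset.sum_mul]
    rw [Finset.sum_comm]
    exact Finset.sum_congr rfl fun _ _ => Finset.sum_congr rfl fun _ _ => by ring
  have e2 : ∑ a, A i a * ∑ b, A a b * (A b i * A b j) = ∑ b, A i b * (A ^ 2) i b * A b j := by
    simp only [hA.sq_apply i, Finset.mul_sum, Finset.sum_mul]
    rw [Finset.sum_comm]
    exact Finset.sum_congr rfl fun b _ => Finset.sum_congr rfl fun _ _ => by
      rw [hA.symm b i]; ring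
  -- `e3` and `e4` evaluate the inner sums in the deleted term `a = j`.
  have e3 : ∑ b, A j b * (A ^ 2) b b * A b j = ∑ b, A j b * (A ^ 2) b b :=
    Finset.sum_congr rfl fun b _ => by
      rw [hA.symm b j]; linear_combination (A ^ 2) b b * hA.mul_self_apply j b
  have e4 : ∑ b, A j b * (A b i * A b j) = (A ^ 2) i j := by
    rw [hA.pow_symm, hA.sq_apply]
    exact Finset.sum_congr rfl fun b _ => by
      rw [hA.symm b j]; linear_combination A b i * hA.mul_self_apply j b
  have e5 : ∀ a, A i a * (A a j * (A ^ 2) a j) = A i a * (A ^ 2) a j * A a j := fun a => by ring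
  rw [h4, sum_ite_eq_zero_else]
  have key : ∑ a, A i a *
      ((A ^ 4) a j - (A ^ 3) a i - (A ^ 3) a a * A a j - ∑ b, A a b * (A ^ 2) b b * A b j
        - (A ^ 2) a i * ((A ^ 2) i j - A a j) + ∑ b, A a b * (A b i * A b j)
        - (A ^ 2) a a * (A ^ 2) a j + (A ^ 2) a a + (A ^ 2) a j
        - (A ^ 2) a j * ((A ^ 2) j j - 2 - A a j)
        - ((A ^ 3) i j - 2 * (A ^ 2) i i - (A ^ 2) i a * A a j - (A ^ 2) a j + 4 - (A ^ 2) j j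
          + A a j)
        - A a j * ((A ^ 3) j j - 2 * (A ^ 2) i j - 2 * (A ^ 2) a j + 2)) =
      ∑ a, A i a * (A ^ 4) a j - ∑ a, A i a * (A ^ 3) a i - ∑ a, A i a * (A ^ 3) a a * A a j
      - ∑ a, A i a * ∑ b, A a b * (A ^ 2) b b * A b j
      - (∑ a, A i a * (A ^ 2) a i) * (A ^ 2) i j + 2 * ∑ a, A i a * (A ^ 2) i a * A a j
      + ∑ a, A i a * ∑ b, A a b * (A b i * A b j) - ∑ a, A i a * (A ^ 2) a a * (A ^ 2) a j
      + ∑ a, A i a * (A ^ 2) a a + (∑ a, A i a * (A ^ 2) a j) * (4 - (A ^ 2) j j)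
      + 3 * ∑ a, A i a * (A ^ 2) a j * A a j
      - (∑ a, A i a) * ((A ^ 3) i j - 2 * (A ^ 2) i i + 4 - (A ^ 2) j j)
      - (∑ a, A i a * A a j) * ((A ^ 3) j j - 2 * (A ^ 2) i j + 3) := by
    simp only [Finset.mul_sum _ _ (2 : ℝ), Finset.mul_sum _ _ (3 : ℝ),
      Finset.sum_mul, ← Finset.sum_add_distrib, ← Finset.sum_sub_distrib]
    refine Finset.sum_congr rfl fun a _ => ?_
    rw [hA.pow_symm 2 a i]
    ring
  rw [key, e1, e2, e3, e4, ← pow_succ_apply A 4, ← pow_succ_apply A 3, ← pow_succ_apply A 2,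
    ← pow_succ_apply A 2, ← hA.sq_apply, ← hA.degree_eq]
  simp only [hij, hA.loopless, hA.pow_symm 2 j i, hA.pow_symm 3 j i]
  ring

/-! ### Cycles through an edge as tours with prescribed ends -/

section CycleTours

open SimpleGraph

/-- The closed tours of an `n`-cycle that start with `i` and end with `j`. -/
def cycleTours {V : Type*} (G : SimpleGraph V) (n : ℕ) (i j : V) : Set (Fin (n + 2) → V) :=
  {f | Function.Injective f ∧ (∀ k, G.Adj (f k) (f (k + 1))) ∧ f 0 = i ∧ f (-1) = j}

/-- An injective closed tour, as a copy of the cycle graph. -/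
def tourCopy {V : Type*} {G : SimpleGraph V} {n : ℕ} (f : Fin (n + 2) → V)
    (hf : Function.Injective f) (hadj : ∀ k, G.Adj (f k) (f (k + 1))) :
    Copy (cycleGraph (n + 2)) G where
  toHom :=
    { toFun := f
      map_rel' := fun {u v} h => by
        rcases cycleGraph_adj.1 h with h | h
        · rw [eq_add_of_sub_eq' h]; exact (hadj v).symm
        · rw [eq_add_of_sub_eq' h]; exact hadj u }
  injective' := hf

theorem tourCopy_toSubgraph_adj {V : Type*} {G : SimpleGraph V} {n : ℕ} {f : Fin (n + 2) → V}
    (hf : Function.Injective f) (hadj : ∀ k, G.Adj (f k) (f (k + 1))) (x y : V) :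
    (tourCopy f hf hadj).toSubgraph.Adj x y ↔
      ∃ k, (f k = x ∧ f (k + 1) = y) ∨ (f k = y ∧ f (k + 1) = x) := by
  rw [Copy.toSubgraph, Subgraph.map_adj]
  constructor
  · rintro ⟨u, v, h, rfl, rfl⟩
    rcases cycleGraph_adj.1 h with h | h
    · exact ⟨v, Or.inr ⟨rfl, congrArg f (eq_add_of_sub_eq' h).symm⟩⟩
    · exact ⟨u, Or.inl ⟨rfl, congrArg f (eq_add_of_sub_eq' h).symm⟩⟩
  · rintro ⟨k, ⟨rfl, rfl⟩ | ⟨rfl, rfl⟩⟩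
    · exact ⟨k, k + 1, cycleGraph_adj.2 (Or.inr (by simp)), rfl, rfl⟩
    · exact ⟨k + 1, k, cycleGraph_adj.2 (Or.inl (by simp)), rfl, rfl⟩

theorem tourCopy_toSubgraph_verts {V : Type*} {G : SimpleGraph V} {n : ℕ} {f : Fin (n + 2) → V}
    (hf : Function.Injective f) (hadj : ∀ k, G.Adj (f k) (f (k + 1))) :
    (tourCopy f hf hadj).toSubgraph.verts = Set.range f := by
  simp [Copy.toSubgraph]; rfl

/-- In a cycle, two consecutive vertices determine the next one: it is the neighbour of the second
that differs from the first. The tours agree at `-1` and `0`, hence everywhere. The bound on `n`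
makes `k - 1` and `k + 1` different indices. -/
theorem tour_ext {V : Type*} {G : SimpleGraph V} {n : ℕ} (hn : 1 ≤ n) {f g : Fin (n + 2) → V}
    (hf : Function.Injective f) (hfadj : ∀ k, G.Adj (f k) (f (k + 1)))
    (hg : Function.Injective g) (hgadj : ∀ k, G.Adj (g k) (g (k + 1)))
    (h0 : f 0 = g 0) (h1 : f (-1) = g (-1))
    (h : (tourCopy f hf hfadj).toSubgraph = (tourCopy g hg hgadj).toSubgraph) : f = g := by
  have two : (1 : Fin (n + 2)) + 1 ≠ 0 := by
    intro h
    have := congrArg Fin.val h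
    rw [Fin.val_add, Fin.val_one, Nat.mod_eq_of_lt (by omega)] at this
    simp at this
  have step : ∀ k, f (k - 1) = g (k - 1) → f k = g k → f (k + 1) = g (k + 1) := by
    intro k hp hk
    have hadj : (tourCopy f hf hfadj).toSubgraph.Adj (f k) (f (k + 1)) :=
      (tourCopy_toSubgraph_adj hf hfadj _ _).2 ⟨k, Or.inl ⟨rfl, rfl⟩⟩
    rw [h, tourCopy_toSubgraph_adj] at hadj
    obtain ⟨m, ⟨e1, e2⟩ | ⟨e1, e2⟩⟩ := hadj
    · rw [hk] at e1
      rw [← e2, hg e1]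
    · rw [hk] at e2
      have hm : m = k - 1 := eq_sub_of_add_eq (hg e2)
      rw [hm, ← hp] at e1
      have := hf e1
      refine absurd ?_ two
      rw [show (1 : Fin (n + 2)) + 1 = k + 1 - (k - 1) by abel, ← this, sub_self]
  have all : ∀ m : Fin (n + 2), f (m - 1) = g (m - 1) ∧ f m = g m := by
    intro m
    induction m using Fin.induction with
    | zero => simpa using ⟨h1, h0⟩
    | succ m ih =>
      rw [← Fin.coeSucc_eq_succ, add_sub_cancel_right]
      exact ⟨ih.2, step _ ih.1 ih.2⟩
  exact funext fun k => (all k).2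

/-- The symmetries of the cycle graph act transitively on its oriented edges, so a given isomorphism
can be adjusted to put `i` at `0` and `j` at `-1`. -/
theorem exists_tour {V : Type*} {G : SimpleGraph V} {n : ℕ} {i j : V} (H : G.Subgraph)
    (e : H.coe ≃g cycleGraph (n + 2)) (hij : H.Adj i j) :
    ∃ (f : Fin (n + 2) → V) (hf : Function.Injective f) (hadj : ∀ k, G.Adj (f k) (f (k + 1))),
      f 0 = i ∧ f (-1) = j ∧ (tourCopy f hf hadj).toSubgraph = H := by
  have adj_iff : ∀ u v, H.Adj (e.symm u) (e.symm v) ↔ (cycleGraph (n + 2)).Adj u v :=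
    fun u v => e.symm.map_adj_iff
  obtain ⟨u, hu⟩ : ∃ u, (e.symm u : V) = i := ⟨e ⟨i, H.edge_vert hij⟩, by simp⟩
  obtain ⟨v, hv⟩ : ∃ v, (e.symm v : V) = j := ⟨e ⟨j, H.edge_vert hij.symm⟩, by simp⟩
  suffices ∃ σ : Fin (n + 2) ≃ Fin (n + 2), σ 0 = u ∧ σ (-1) = v ∧
      ∀ a b, (cycleGraph (n + 2)).Adj (σ a) (σ b) ↔ (cycleGraph (n + 2)).Adj a b by
    obtain ⟨σ, h0, h1, hσ⟩ := this
    have hf : Function.Injective fun k => (e.symm (σ k) : V) :=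
      Subtype.val_injective.comp (e.symm.injective.comp σ.injective)
    have hadj : ∀ k, H.Adj (e.symm (σ k)) (e.symm (σ (k + 1))) := fun k => by
      rw [adj_iff, hσ, cycleGraph_adj]; simp
    refine ⟨fun k => e.symm (σ k), hf, fun k => (hadj k).adj_sub, by simp [h0, hu],
      by simp [h1, hv], ?_⟩
    ext x y
    · rw [tourCopy_toSubgraph_verts]
      constructor
      · rintro ⟨k, rfl⟩; exact (e.symm (σ k)).2
      · intro hx; exact ⟨σ.symm (e ⟨x, hx⟩), by simp⟩
    · rw [tourCopy_toSubgraph_adj]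
      constructor
      · rintro ⟨k, ⟨rfl, rfl⟩ | ⟨rfl, rfl⟩⟩
        · exact hadj k
        · exact (hadj k).symm
      · intro hxy
        obtain ⟨a, rfl⟩ : ∃ a, (e.symm (σ a) : V) = x :=
          ⟨σ.symm (e ⟨x, H.edge_vert hxy⟩), by simp⟩
        obtain ⟨b, rfl⟩ : ∃ b, (e.symm (σ b) : V) = y :=
          ⟨σ.symm (e ⟨y, H.edge_vert hxy.symm⟩), by simp⟩
        rw [adj_iff, hσ, cycleGraph_adj] at hxy
        rcases hxy with h | h
        · exact ⟨b, Or.inr ⟨rfl, by rw [eq_add_of_sub_eq' h]⟩⟩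
        · exact ⟨a, Or.inl ⟨rfl, by rw [eq_add_of_sub_eq' h]⟩⟩
  -- If `u - v = 1` the rotation `k ↦ k + u` serves; if `v - u = 1`, the reflection `k ↦ u - k`.
  rw [← hu, ← hv, adj_iff, cycleGraph_adj] at hij
  rcases hij with h | h
  · refine ⟨Equiv.addRight u, by simp, ?_, fun a b => ?_⟩
    · simp [eq_add_of_sub_eq' h]
    · simp [cycleGraph_adj]
  · refine ⟨Equiv.subLeft u, by simp, ?_, fun a b => ?_⟩
    · simp [eq_add_of_sub_eq' h]
    · simp [cycleGraph_adj, or_comm]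

/-- Here `n` counts the inner vertices of the path from `i` to `j`, so the cycle length is `n + 2`.
-/
theorem cycleCount_eq_ncard {V : Type*} (G : SimpleGraph V) {n : ℕ} (hn : 1 ≤ n) (i j : V) :
    cycleCount G (n + 2) i j = (cycleTours G n i j).ncard := by
  symm
  refine Set.ncard_congr (fun f hf => (tourCopy f hf.1 hf.2.1).toSubgraph) ?_ ?_ ?_
  · rintro f ⟨hf, hadj, rfl, rfl⟩
    exact ⟨⟨(Copy.isoToSubgraph _).symm⟩,
      (tourCopy_toSubgraph_adj hf hadj _ _).2 ⟨-1, Or.inr ⟨rfl, by simp⟩⟩⟩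
  · rintro f g ⟨hf, hfa, f0, f1⟩ ⟨hg, hga, g0, g1⟩ h
    exact tour_ext hn hf hfa hg hga (f0.trans g0.symm) (f1.trans g1.symm) h
  · rintro H ⟨⟨e⟩, hij⟩
    obtain ⟨f, hf, hadj, h0, h1, h⟩ := exists_tour H e hij
    exact ⟨f, ⟨hf, hadj, h0, h1⟩, h⟩

end CycleTours

/-! ### Entries of the matrices `X_l` at an edge -/

omit [Fintype V] [DecidableEq V] in
theorem isAdj_adjMatrix (G : SimpleGraph V) [DecidableRel G.Adj] : IsAdj (G.adjMatrix ℝ) where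
  zero_or_one x y := by by_cases h : G.Adj x y <;> simp [h]
  symm x y := by simp [G.adj_comm]
  loopless x := by simp

omit [Fintype V] in
theorem hadamard_one_eq_diagonal (M : Matrix V V ℝ) : M ⊙ 1 = Matrix.diagonal fun x => M x x := by
  ext x y
  by_cases h : x = y <;> simp [Matrix.hadamard_apply, h]

omit [Fintype V] in
theorem diagonal_sub_smul_one (v : V → ℝ) (c : ℝ) :
    Matrix.diagonal v - c • (1 : Matrix V V ℝ) = Matrix.diagonal fun x => v x - c := by
  ext x y
  by_cases h : x = y <;> simp [h]

omit [Fintype V] in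
theorem diagonal_sub_one (v : V → ℝ) :
    Matrix.diagonal v - (1 : Matrix V V ℝ) = Matrix.diagonal fun x => v x - 1 := by
  simpa using diagonal_sub_smul_one v 1

omit [Fintype V] in
theorem hadamard_offDiagOnes_apply (M : Matrix V V ℝ) (x y : V) :
    (M ⊙ offDiagOnes V) x y = M x y - if x = y then M x x else 0 := by
  by_cases h : x = y <;> simp [Matrix.hadamard_apply, offDiagOnes, h]

omit [Fintype V] in
theorem hadamard_offDiagOnes_apply_ne (M : Matrix V V ℝ) {x y : V} (h : x ≠ y) :
    (M ⊙ offDiagOnes V) x y = M x y := by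
  rw [hadamard_offDiagOnes_apply, if_neg h, sub_zero]

theorem X3_apply (hA : IsAdj A) {i j : V} (hij : A i j = 1) :
    X3 A i j = (A ^ 3) i j - (A ^ 2) i i - (A ^ 2) j j + 1 := by
  have hne := hA.ne hij
  simp only [X3, Matrix.add_apply, Matrix.sub_apply, hadamard_one_eq_diagonal,
    hadamard_offDiagOnes_apply_ne _ hne, Matrix.mul_diagonal, Matrix.diagonal_mul, hij]
  ring

theorem X2_apply_ne {i j : V} (hne : i ≠ j) : X2 A i j = (A ^ 2) i j :=
  hadamard_offDiagOnes_apply_ne _ hne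

/-- The coefficient `5` collects `2` from the summand `2I` and `3` from the last summand of `X4`. -/
theorem X4_apply (hA : IsAdj A) {i j : V} (hij : A i j = 1) :
    X4 A i j = (A ^ 4) i j - ∑ a, A i a * (A ^ 2) a a * A a j
      - ((A ^ 2) i i + (A ^ 2) j j) * (A ^ 2) i j
      - (A ^ 3) i i - (A ^ 3) j j + 5 * (A ^ 2) i j := by
  have hne := hA.ne hij
  simp only [X4, Matrix.add_apply, Matrix.sub_apply, hadamard_one_eq_diagonal, X2_apply_ne hne,
    hadamard_offDiagOnes_apply_ne _ hne, diagonal_sub_smul_one, Matrix.mul_apply (M := _ * _),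
    Matrix.mul_diagonal, Matrix.diagonal_mul, Matrix.smul_apply, Matrix.hadamard_apply, hij,
    mul_sub, sub_mul, Finset.sum_sub_distrib, smul_eq_mul]
  simp only [hA.sq_apply i j, mul_comm _ (2 : ℝ), mul_assoc, ← Finset.mul_sum]
  ring

theorem hadamard_X3_mulVec_one (hA : IsAdj A) (x : V) :
    ((A ⊙ X3 A) *ᵥ 1) x =
      (A ^ 4) x x - (A ^ 2) x x ^ 2 - ∑ a, A x a * (A ^ 2) a a + (A ^ 2) x x := by
  have h : ∀ a, A x a * X3 A x a =
      A x a * (A ^ 3) a x - A x a * (A ^ 2) x x - A x a * (A ^ 2) a a + A x a := fun a => by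
    rw [hA.mul_congr fun h => X3_apply hA h, hA.pow_symm 3 x a]
    ring
  simp only [Matrix.mulVec, dotProduct, Matrix.hadamard_apply, Pi.one_apply, mul_one, h,
    Finset.sum_add_distrib, Finset.sum_sub_distrib, ← Finset.sum_mul, ← hA.degree_eq]
  rw [pow_succ_apply A 3]
  ring

/-- The entries of `A ^ 2` are nonnegative, so multiplying one by its positivity indicator leaves it
unchanged. -/
theorem hadamard_sq_sub_posIndicator_apply (hA : IsAdj A) (x y : V) :
    (A ^ 2) x y * ((A ^ 2) x y - posIndicator (A ^ 2) x y) =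
      (A ^ 2) x y ^ 2 - (A ^ 2) x y := by
  have h : 0 ≤ (A ^ 2) x y := by
    rw [hA.sq_apply]
    refine Finset.sum_nonneg fun z _ => mul_nonneg ?_ ?_
    · rcases hA.zero_or_one x z with h | h <;> simp [h]
    · rcases hA.zero_or_one z y with h | h <;> simp [h]
  rcases h.eq_or_lt with h | h
  · simp [← h]
  · simp only [posIndicator, Matrix.of_apply, if_pos h]
    ring

theorem X5_apply (hA : IsAdj A) {i j : V} (hij : A i j = 1) :
    X5 A i j = (A ^ 5) i j - (A ^ 4) i i - (A ^ 4) j j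
      - ∑ a, A i a * (A ^ 3) a a * A a j
      - ∑ a, (A ^ 2) i a * (A ^ 2) a a * A a j - ∑ a, A i a * (A ^ 2) a a * (A ^ 2) a j
      - ((A ^ 3) i i + (A ^ 3) j j) * (A ^ 2) i j
      + 3 * ∑ a, A i a * (A ^ 2) i a * A a j + 3 * ∑ a, A i a * (A ^ 2) a j * A a j
      + ∑ a, A i a * (A ^ 2) a a + ∑ a, A j a * (A ^ 2) a a
      + (A ^ 3) i j * (6 - (A ^ 2) i i - (A ^ 2) j j)
      + 2 * (A ^ 2) i i ^ 2 + 2 * (A ^ 2) j j ^ 2 + (A ^ 2) i i * (A ^ 2) j j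
      - 6 * (A ^ 2) i i - 6 * (A ^ 2) j j + 4 + 3 * (A ^ 2) i j ^ 2 - 4 * (A ^ 2) i j := by
  have hne := hA.ne hij
  -- `X2` is `A ^ 2` with its diagonal erased; the last term on the right is the lost contribution
  -- of the middle vertex `j` (of `i` in `e2`).
  have e1 : (A * Matrix.diagonal (fun x => (A ^ 2) x x - 1) * X2 A) i j =
      ∑ a, A i a * (A ^ 2) a a * (A ^ 2) a j - (A ^ 3) i j
        - ((A ^ 2) j j - 1) * (A ^ 2) j j := by
    simp only [Matrix.mul_apply (M := _ * _), Matrix.mul_diagonal, X2,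
      hadamard_offDiagOnes_apply, mul_sub, sub_mul, Finset.sum_sub_distrib, mul_ite, mul_zero,
      Finset.sum_ite_eq', Finset.mem_univ, if_true, mul_one, pow_succ_apply A 2, hij]
    ring
  have e2 : (X2 A * Matrix.diagonal (fun x => (A ^ 2) x x - 1) * A) i j =
      ∑ a, (A ^ 2) i a * (A ^ 2) a a * A a j - (A ^ 3) i j
        - ((A ^ 2) i i - 1) * (A ^ 2) i i := by
    simp only [Matrix.mul_apply (M := _ * _), Matrix.mul_diagonal, X2,
      hadamard_offDiagOnes_apply, mul_sub, sub_mul, Finset.sum_sub_distrib, ite_mul, zero_mul,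
      Finset.sum_ite_eq, Finset.mem_univ, if_true, mul_one, pow_succ_apply' A 2, hij]
    ring
  have e3 : (A * Matrix.diagonal (fun x => (A ^ 3) x x) * A) i j =
      ∑ a, A i a * (A ^ 3) a a * A a j := by
    simp only [Matrix.mul_apply (M := _ * _), Matrix.mul_diagonal]
  have e4 : (A * (A ⊙ (A ^ 2)) + (A ⊙ (A ^ 2)) * A) i j =
      ∑ a, A i a * (A ^ 2) i a * A a j + ∑ a, A i a * (A ^ 2) a j * A a j := by
    rw [add_comm, Matrix.add_apply, Matrix.mul_apply, Matrix.mul_apply]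
    simp only [Matrix.hadamard_apply]
    exact congrArg₂ _ rfl (Finset.sum_congr rfl fun _ _ => by ring)
  have e5 : (A ⊙ (A ^ 2) ⊙ (A ^ 2 - posIndicator (A ^ 2))) i j =
      (A ^ 2) i j ^ 2 - (A ^ 2) i j := by
    rw [Matrix.hadamard_apply, Matrix.hadamard_apply, hij, one_mul, Matrix.sub_apply,
      hadamard_sq_sub_posIndicator_apply hA]
  simp only [X5, Matrix.add_apply (m := V), Matrix.sub_apply, Matrix.smul_apply,
    hadamard_one_eq_diagonal, diagonal_sub_one, X2_apply_ne hne, hadamard_offDiagOnes_apply_ne _ hne,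
    e1, e2, e3, Matrix.mul_diagonal, Matrix.diagonal_mul, X3_apply hA hij,
    hadamard_X3_mulVec_one hA, smul_eq_mul]
  simp only [← Matrix.add_apply, e4, e5, Matrix.hadamard_apply, hij, X3_apply hA hij,
    Matrix.diagonal_mul_diagonal, Matrix.diagonal_mul]
  ring

/-! ### Tours counted by the nested sums -/

omit [Fintype V] [DecidableEq V] in
theorem ite_mul_sum_eq {ι : Type*} (s : Finset ι) (p : Prop) [Decidable p] (x : ℝ) (g : ι → ℝ) :
    (if p then 0 else x * ∑ b ∈ s, g b) = ∑ b ∈ s, if p then 0 else x * g b := by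
  split_ifs
  · simp
  · rw [Finset.mul_sum]

/-- With `ite_mul_sum_eq`, this merges the guards and adjacency factors of a nested sum into one
indicator of a conjunction. -/
theorem ite_mul_boole (p q r : Prop) [Decidable p] [Decidable q] [Decidable r] :
    (if p then (0 : ℝ) else (if q then 1 else 0) * if r then 1 else 0) =
      if ¬p ∧ q ∧ r then 1 else 0 := by
  by_cases p <;> by_cases q <;> by_cases r <;> simp [*]

omit [Fintype V] [DecidableEq V] in
/-- Counting closed tours by their inner vertices, given as an element of `T`. -/
theorem ncard_cycleTours_eq {T : Type*} [Fintype T] (G : SimpleGraph V) {n : ℕ} {i j : V}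
    (P : T → Prop) [DecidablePred P] (F : T → Fin (n + 2) → V) (hF : Function.Injective F)
    (hP : ∀ t, P t ↔ F t ∈ cycleTours G n i j)
    (hsurj : ∀ f : Fin (n + 2) → V, f 0 = i → f (-1) = j → ∃ t, F t = f) :
    ((cycleTours G n i j).ncard : ℝ) = ∑ t, if P t then 1 else 0 := by
  have h : cycleTours G n i j = F '' ↑(Finset.univ.filter P) := by
    ext f
    simp only [Finset.coe_filter, Finset.mem_univ, true_and, Set.mem_image, Set.mem_ofPred_eq, hP]
    refine ⟨fun hf => ?_, fun ⟨t, ht, e⟩ => e ▸ ht⟩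
    obtain ⟨t, rfl⟩ := hsurj f hf.2.2.1 hf.2.2.2
    exact ⟨t, hf, rfl⟩
  rw [h, Set.ncard_image_of_injective _ hF, Set.ncard_coe_finset, Finset.sum_boole]

variable (G : SimpleGraph V) [DecidableRel G.Adj] {i j : V}

theorem ncard_cycleTours_one (hij : G.Adj i j) :
    ((cycleTours G 1 i j).ncard : ℝ) = (G.adjMatrix ℝ ^ 2) i j := by
  rw [ncard_cycleTours_eq G (fun a : V => G.Adj i a ∧ G.Adj a j) (fun a => ![i, a, j]),
    (isAdj_adjMatrix G).sq_apply]
  · exact Finset.sum_congr rfl fun a _ => by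
      by_cases h : G.Adj i a <;> by_cases h' : G.Adj a j <;> simp [h, h']
  · intro a a' h
    exact congrFun h 1
  · intro a
    constructor
    · rintro ⟨h1, h2⟩
      -- Injectivity becomes a finite list of inequalities between the entries.
      refine ⟨List.nodup_ofFn.1 ?_, ?_, rfl, rfl⟩
      · simp [h1.ne, h2.ne, hij.ne]
      · intro k
        fin_cases k
        exacts [h1, h2, hij.symm]
    · rintro ⟨-, h, -⟩
      exact ⟨h 0, h 1⟩
  · rintro f rfl rfl
    exact ⟨f 1, funext fun k => by fin_cases k <;> rfl⟩

theorem ncard_cycleTours_two (hij : G.Adj i j) :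
    ((cycleTours G 2 i j).ncard : ℝ) = pathSum3 (G.adjMatrix ℝ) i j := by
  simp only [pathSum3, SimpleGraph.adjMatrix_apply, ite_mul_sum_eq, ite_mul_boole]
  rw [ncard_cycleTours_eq G (fun t : V × V => ¬t.1 = j ∧ G.Adj i t.1 ∧ ¬t.2 = i ∧
    G.Adj t.1 t.2 ∧ G.Adj t.2 j) (fun t => ![i, t.1, t.2, j])]
  · simp only [Fintype.sum_prod_type]
  · intro t t' h
    exact Prod.ext (congrFun h 1) (congrFun h 2)
  · rintro ⟨a, b⟩
    constructor
    · rintro ⟨haj, h1, hbi, h2, h3⟩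
      refine ⟨List.nodup_ofFn.1 ?_, ?_, rfl, rfl⟩
      -- Adjacent vertices differ, including the pair `i`, `j`; the guards supply the remaining
      -- inequalities.
      · simp [h1.ne, h2.ne, h3.ne, hij.ne, haj, Ne.symm hbi]
      · intro k
        fin_cases k
        exacts [h1, h2, h3, hij.symm]
    · rintro ⟨hf, h, -⟩
      exact ⟨hf.ne (a₁ := 1) (a₂ := 3) (by decide), h 0, hf.ne (a₁ := 2) (a₂ := 0) (by decide),
        h 1, h 2⟩
  · rintro f rfl rfl
    exact ⟨(f 1, f 2), funext fun k => by fin_cases k <;> rfl⟩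

theorem ncard_cycleTours_three (hij : G.Adj i j) :
    ((cycleTours G 3 i j).ncard : ℝ) = pathSum4 (G.adjMatrix ℝ) i j := by
  simp only [pathSum4, SimpleGraph.adjMatrix_apply, ite_mul_sum_eq, ite_mul_boole]
  rw [ncard_cycleTours_eq G (fun t : V × V × V => ¬t.1 = j ∧ G.Adj i t.1 ∧
    ¬(t.2.1 = i ∨ t.2.1 = j) ∧ G.Adj t.1 t.2.1 ∧ ¬(t.2.2 = i ∨ t.2.2 = t.1) ∧
    G.Adj t.2.1 t.2.2 ∧ G.Adj t.2.2 j) (fun t => ![i, t.1, t.2.1, t.2.2, j])]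
  · simp only [Fintype.sum_prod_type]
  · intro t t' h
    exact Prod.ext (congrFun h 1) (Prod.ext (congrFun h 2) (congrFun h 3))
  · rintro ⟨a, b, c⟩
    constructor
    · rintro ⟨haj, h1, hb, h2, hc, h3, h4⟩
      simp only [not_or, ← ne_eq] at hb hc haj
      refine ⟨List.nodup_ofFn.1 ?_, ?_, rfl, rfl⟩
      · simp [h1.ne, h2.ne, h3.ne, h4.ne, hij.ne, haj, hb.1.symm, hb.2, hc.1.symm, hc.2.symm]
      · intro k
        fin_cases k
        exacts [h1, h2, h3, h4, hij.symm]
    · rintro ⟨hf, h, -⟩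
      exact ⟨hf.ne (a₁ := 1) (a₂ := 4) (by decide), h 0,
        not_or.2 ⟨hf.ne (a₁ := 2) (a₂ := 0) (by decide), hf.ne (a₁ := 2) (a₂ := 4) (by decide)⟩,
        h 1,
        not_or.2 ⟨hf.ne (a₁ := 3) (a₂ := 0) (by decide), hf.ne (a₁ := 3) (a₂ := 1) (by decide)⟩,
        h 2, h 3⟩
  · rintro f rfl rfl
    exact ⟨(f 1, f 2, f 3), funext fun k => by fin_cases k <;> rfl⟩

theorem ncard_cycleTours_four (hij : G.Adj i j) :
    ((cycleTours G 4 i j).ncard : ℝ) = pathSum5 (G.adjMatrix ℝ) i j := by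
  simp only [pathSum5, SimpleGraph.adjMatrix_apply, ite_mul_sum_eq, ite_mul_boole]
  rw [ncard_cycleTours_eq G (fun t : V × V × V × V => ¬t.1 = j ∧ G.Adj i t.1 ∧
    ¬(t.2.1 = i ∨ t.2.1 = j) ∧ G.Adj t.1 t.2.1 ∧
    ¬(t.2.2.1 = i ∨ t.2.2.1 = t.1 ∨ t.2.2.1 = j) ∧ G.Adj t.2.1 t.2.2.1 ∧
    ¬(t.2.2.2 = i ∨ t.2.2.2 = t.1 ∨ t.2.2.2 = t.2.1) ∧
    G.Adj t.2.2.1 t.2.2.2 ∧ G.Adj t.2.2.2 j) (fun t => ![i, t.1, t.2.1, t.2.2.1, t.2.2.2, j])]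
  · simp only [Fintype.sum_prod_type]
  · intro t t' h
    exact Prod.ext (congrFun h 1)
      (Prod.ext (congrFun h 2) (Prod.ext (congrFun h 3) (congrFun h 4)))
  · rintro ⟨a, b, c, d⟩
    constructor
    · rintro ⟨haj, h1, hb, h2, hc, h3, hd, h4, h5⟩
      simp only [not_or, ← ne_eq] at hb hc hd haj
      refine ⟨List.nodup_ofFn.1 ?_, ?_, rfl, rfl⟩
      · simp [h1.ne, h2.ne, h3.ne, h4.ne, h5.ne, hij.ne, haj, hb.1.symm, hb.2, hc.1.symm,
          hc.2.1.symm, hc.2.2, hd.1.symm, hd.2.1.symm, hd.2.2.symm]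
      · intro k
        fin_cases k
        exacts [h1, h2, h3, h4, h5, hij.symm]
    · rintro ⟨hf, h, -⟩
      have ne : ∀ u v : Fin 6, u ≠ v → ![i, a, b, c, d, j] u ≠ ![i, a, b, c, d, j] v :=
        fun u v huv => hf.ne huv
      exact ⟨ne 1 5 (by decide), h 0,
        not_or.2 ⟨ne 2 0 (by decide), ne 2 5 (by decide)⟩, h 1,
        not_or.2 ⟨ne 3 0 (by decide), not_or.2 ⟨ne 3 1 (by decide), ne 3 5 (by decide)⟩⟩, h 2,
        not_or.2 ⟨ne 4 0 (by decide), not_or.2 ⟨ne 4 1 (by decide), ne 4 2 (by decide)⟩⟩,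
        h 3, h 4⟩
  · rintro f rfl rfl
    exact ⟨(f 1, f 2, f 3, f 4), funext fun k => by fin_cases k <;> rfl⟩

end EdgeCycles

/-! ### Comparison for each cycle length -/

open EdgeCycles in
theorem mainTheorem5 {V : Type*} [Fintype V] [DecidableEq V]
    (G : SimpleGraph V) [DecidableRel G.Adj] (l : ℕ) (hl3 : 3 ≤ l) (hl6 : l ≤ 6) (i j : V) :
    EdgeCycles.C (G.adjMatrix ℝ) l i j = (EdgeCycles.cycleCount G l i j : ℝ) := by
  rw [C, Matrix.hadamard_apply]
  by_cases hij : G.Adj i j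
  · have hA := isAdj_adjMatrix G
    have h1 : G.adjMatrix ℝ i j = 1 := by simp [hij]
    rw [h1, one_mul]
    interval_cases l
    · rw [cycleCount_eq_ncard G (n := 1) (by norm_num), ncard_cycleTours_one G hij]
      exact X2_apply_ne hij.ne
    · rw [cycleCount_eq_ncard G (n := 2) (by norm_num), ncard_cycleTours_two G hij,
        pathSum3_eq hA h1]
      exact X3_apply hA h1
    · rw [cycleCount_eq_ncard G (n := 3) (by norm_num), ncard_cycleTours_three G hij,
        pathSum4_eq hA h1]
      exact X4_apply hA h1
    · rw [cycleCount_eq_ncard G (n := 4) (by norm_num), ncard_cycleTours_four G hij,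
        pathSum5_eq hA h1]
      exact X5_apply hA h1
  · have h : cycleCount G l i j = 0 := by
      rw [cycleCount, (Set.eq_empty_iff_forall_notMem (s := {H : G.Subgraph | _})).2
        fun H hH => hij hH.2.adj_sub, Set.ncard_empty]
    simp [h, hij]
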